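/- **Setting.** There are finitely many advertisers $i\in N$ and finitely many rich ads $j\in J$. Ad $j$, if shown for $i$, has a public click probability $\alpha_{ij}\in[0,1]$ and occupies a public space $w_{ij}$ with $0<w_{ij}\le W$, where $W>0$ is the total space. Advertiser $i$ has a true value per click $v_i\ge 0$ and a true set of ads $A_i\subseteq J$; she reports a bid $b_i\ge 0$ and a set $S_i\subseteq A_i$. Put $v_{ij}=\alpha_{ij}v_i$ if $j\in A_i$ and $v_{ij}=0$ otherwise; $b_{ij}=\alpha_{ij}b_i$ if $j\in S_i$ and $b_{ij}=0$ otherwise. An integral allocation gives each advertiser at most one ad. If $x_i$ is the (expected) number of clicks of $i$, i.e. $\alpha_{ij}$ when $i$ is shown ad $j$ and $0$ when she is shown nothing, the social welfare is the sum of the values $v_{ij}$ of the ads shown. $OPT(\mathbf v,\mathbf A)$ is the largest welfare $\sum_i v_{i\tau(i)}$ of an integral allocation $\tau$ whose total space is at most $W$. **Mechanism.** Ties are broken by arbitrary fixed priority orders on the pairs $(i,j)$. *Bang-per-buck rule.* Start with remaining space $w=W$, $E_i=S_i$ and $W_i=0$ for all $i$. While $w>0$ and some $E_i$ is non-empty: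 take the pair $(i,j)$, $j\in E_i$, with the largest $b_{ij}/w_{ij}$; delete from $E_i$ all ads of space at most $w_{ij}$; if $w_{ij}-W_i\le w$, decrease $w$ by $w_{ij}-W_i$ and set $W_i=w_{ij}$; otherwise increase $W_i$ by $w$ and set $w=0$. At the end each $i$ is shown an ad $j\in S_i$ with $w_{ij}\le W_i$ of largest $b_{ij}$ (no ad if there is none). *Max-value rule.* Only the reported ad with the largest $b_{ij}$ is shown. For either rule, the GSP cost per click of $i$ is $cpc_i=\inf\{t\ge 0: x_i(t,\mathbf b_{-i},\mathbf S)=x_i(\mathbf b,\mathbf S)\}$, the payment is $x_i\cdot cpc_i$, and the utility of $i$ is $v_ix_i-x_i\,cpc_i$. The mechanism runs each of the two rules with probability $1/2$ and charges the GSP payment of the rule that was run; $u_i$ and $SW(\mathbf b,\mathbf S)$ denote the expected utility and the expected social welfare over this coin flip. **Definition.** Under no overbidding, the mechanism is $(\lambda,\mu)$ semi-smooth if for every advertiser $i$ and every value $v_i\ge0$ there is a probability distribution $D_i(v_i)$ of nonnegative bids such that for all $(\mathbf v,\mathbf A)$ and all reports $(\mathbf b,\mathbf S)$ with $0\le b_i\le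 v_i$ and $S_i\subseteq A_i$ for all $i$, the deviation utilities are integrable and $$\sum_i \mathbb E_{y\sim D_i(v_i)}\big[u_i(y,A_i,\mathbf b_{-i},\mathbf S_{-i})\big]\ \ge\ \lambda\, OPT(\mathbf v,\mathbf A)-\mu\, SW(\mathbf b,\mathbf S).$$ **Theorem.** The mechanism is $\left(\tfrac12\left(1-\tfrac1e\right),2\right)$ semi-smooth under no overbidding. Moreover, this holds with $D_i(v_i)$ the distribution with density $y\mapsto \frac{1}{v_i-y}$ on $[0,v_i(1-1/e)]$ when $v_i>0$, and the unit mass at $0$ when $v_i=0$. -/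

import Mathlib

open MeasureTheory

noncomputable section

namespace RichAds

/-- The public data of a rich-ads auction with advertisers `N` and universe of rich ads `J`:
click probabilities `α i j`, spaces `w i j` and the total space `W`. -/
structure Instance (N J : Type*) where
  α : N → J → ℝ
  w : N → J → ℝ
  W : ℝ
  α_nonneg : ∀ i j, 0 ≤ α i j
  α_le_one : ∀ i j, α i j ≤ 1
  w_pos : ∀ i j, 0 < w i j
  w_le : ∀ i j, w i j ≤ W
  W_pos : 0 < W

/-- Fixed priorities (a smaller number wins) that resolve ties in the bang-per-buck order,
in the post-processing step and in the choice of the maximum-value ad. -/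
structure TieBreaking (N J : Type*) where
  bpb : N × J → ℕ
  post : N × J → ℕ
  maxv : N × J → ℕ
  bpb_inj : Function.Injective bpb
  post_inj : Function.Injective post
  maxv_inj : Function.Injective maxv

/-- The element of `C` with the highest score; among those, the one of smallest `tie`.
It is `none` exactly when `C` is empty, and it is unique when `tie` is injective. -/
def pick {β : Type*} (C : Finset β) (score : β → ℝ) (tie : β → ℕ) : Option β :=
  open scoped Classical in
  if h : C.Nonempty then
    some (Finset.exists_max_image C
      (fun p => (toLex (score p, OrderDual.toDual (tie p)) : ℝ ×ₗ ℕᵒᵈ)) h).choose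
  else none

variable {N J : Type*} [Fintype N] [DecidableEq N] [Fintype J] [DecidableEq J]

/-- The value of rich ad `j` for advertiser `i` with per-click values (or bids) `v` and sets of
ads `A`: `α i j * v i` if `j ∈ A i`, and `0` otherwise. -/
def val (I : Instance N J) (v : N → ℝ) (A : N → Finset J) (i : N) (j : J) : ℝ :=
  if j ∈ A i then I.α i j * v i else 0

/-- All ads on offer, as pairs (advertiser, ad). -/
def offered (E : N → Finset J) : Finset (N × J) :=
  Finset.univ.filter fun p => p.2 ∈ E p.1

/-! ### The space allocation by bang-per-buck -/

/-- State of the greedy algorithm: remaining space, ads still available to each advertiser, and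
space allotted so far to each advertiser. Until the algorithm stops, `space i` is the space of the
ad currently held by `i` (`0` if there is none). -/
structure GreedyState (N J : Type*) where
  rem : ℝ
  avail : N → Finset J
  space : N → ℝ

/-- One round of the greedy algorithm. It takes the available ad `(i, j)` of highest bang-per-buck
`b_{ij} / w_{ij}`, discards all ads of `i` of space at most `w_{ij}`, and raises the space of `i` to
`w_{ij}` if the remaining space allows it; otherwise `i` receives all of the remaining space.
Nothing happens once space or ads have run out. -/
def greedyStep (I : Instance N J) (T : TieBreaking N J) (b : N → ℝ) (S : N → Finset J)
    (s : GreedyState N J) : GreedyState N J :=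
  open scoped Classical in
  if s.rem ≤ 0 then s else
  match pick (offered s.avail) (fun p => val I b S p.1 p.2 / I.w p.1 p.2) T.bpb with
  | none => s
  | some (i, j) =>
    let avail' := Function.update s.avail i ((s.avail i).filter fun k => I.w i j < I.w i k)
    if I.w i j - s.space i ≤ s.rem then
      { rem := s.rem - (I.w i j - s.space i)
        avail := avail'
        space := Function.update s.space i (I.w i j) }
    else
      { rem := 0
        avail := avail'
        space := Function.update s.space i (s.space i + s.rem) }

/-- The space `W_i` allotted to each advertiser by the greedy algorithm. A round that changes the
state discards at least one ad, so `|N × J|` rounds run the algorithm to the end. -/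
def greedySpace (I : Instance N J) (T : TieBreaking N J) (b : N → ℝ) (S : N → Finset J) : N → ℝ :=
  ((greedyStep I T b S)^[Fintype.card (N × J)]
    { rem := I.W, avail := S, space := fun _ => 0 }).space

/-! ### The two integral allocation rules -/

/-- An integral allocation gives each advertiser one ad or none (the null ad). -/
abbrev Allocation (N J : Type*) := N → Option J

/-- An allocation rule maps a profile of bids and of reported sets of ads to an allocation. -/
abbrev AllocationRule (N J : Type*) := (N → ℝ) → (N → Finset J) → Allocation N J

/-- The bang-per-buck allocation: each advertiser gets its reported ad of highest bid value among
those that fit into the space allotted by the greedy algorithm. -/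
def bpbRule (I : Instance N J) (T : TieBreaking N J) : AllocationRule N J := fun b S i =>
  open scoped Classical in
  pick ((S i).filter fun j => I.w i j ≤ greedySpace I T b S i) (val I b S i)
    (fun j => T.post (i, j))

/-- The max-value allocation: only the reported ad of highest bid value is allocated. -/
def maxRule (I : Instance N J) (T : TieBreaking N J) : AllocationRule N J := fun b S i =>
  match pick (offered S) (fun p => val I b S p.1 p.2) T.maxv with
  | none => none
  | some (k, j) => if i = k then some j else none

/-! ### Clicks, GSP payments, utility, welfare -/

/-- Expected number of clicks of advertiser `i` in an allocation. -/
def clicks (I : Instance N J) (x : Allocation N J) (i : N) : ℝ :=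
  (x i).elim 0 (I.α i)

/-- Space used by advertiser `i` in an allocation. -/
def usedSpace (I : Instance N J) (x : Allocation N J) (i : N) : ℝ :=
  (x i).elim 0 (I.w i)

/-- Social welfare of an allocation for the true types `(v, A)`. -/
def welfare (I : Instance N J) (v : N → ℝ) (A : N → Finset J) (x : Allocation N J) : ℝ :=
  ∑ i, (x i).elim 0 (val I v A i)

/-- The optimal welfare over all integral allocations that fit into the total space. -/
def optWelfare (I : Instance N J) (v : N → ℝ) (A : N → Finset J) : ℝ :=
  sSup {r | ∃ x : Allocation N J, ∑ i, usedSpace I x i ≤ I.W ∧ r = welfare I v A x}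

/-- The GSP cost per click: the infimum of the (nonnegative) bids that give `i` the same number of
clicks, all other reports being fixed. -/
def gspCpc (I : Instance N J) (x : AllocationRule N J) (b : N → ℝ) (S : N → Finset J) (i : N) : ℝ :=
  sInf {t | 0 ≤ t ∧ clicks I (x (Function.update b i t) S) i = clicks I (x b S) i}

/-- The GSP payment: clicks times cost per click. -/
def gspPayment (I : Instance N J) (x : AllocationRule N J) (b : N → ℝ) (S : N → Finset J)
    (i : N) : ℝ :=
  clicks I (x b S) i * gspCpc I x b S i

/-- Quasi-linear utility of advertiser `i` with true value per click `vi` under rule `x` with GSP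
payments (`i`'s own report is contained in its true set, so all its clicks have value `vi`). -/
def gspUtility (I : Instance N J) (x : AllocationRule N J) (i : N) (vi : ℝ) (b : N → ℝ)
    (S : N → Finset J) : ℝ :=
  vi * clicks I (x b S) i - gspPayment I x b S i

/-- Expected utility in the mechanism that runs each of the two rules with probability `1/2` and
charges the GSP payment of the rule that was run. -/
def mixUtility (I : Instance N J) (T : TieBreaking N J) (i : N) (vi : ℝ) (b : N → ℝ)
    (S : N → Finset J) : ℝ :=
  (1 / 2) * gspUtility I (bpbRule I T) i vi b S + (1 / 2) * gspUtility I (maxRule I T) i vi b S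

/-- Expected social welfare of that mechanism at reports `(b, S)` and true types `(v, A)`. -/
def mixWelfare (I : Instance N J) (T : TieBreaking N J) (v : N → ℝ) (A : N → Finset J)
    (b : N → ℝ) (S : N → Finset J) : ℝ :=
  (1 / 2) * welfare I v A (bpbRule I T b S) + (1 / 2) * welfare I v A (maxRule I T b S)

/-! ### Semi-smoothness -/

/-- Admissible true types and reports: nonnegative values and bids, reported ads among the true
ones, and no overbidding. -/
structure NoOverbidding (v : N → ℝ) (A : N → Finset J) (b : N → ℝ) (S : N → Finset J) : Prop where
  bid_nonneg : ∀ i, 0 ≤ b i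
  bid_le : ∀ i, b i ≤ v i
  report_sub : ∀ i, S i ⊆ A i

/-- The mechanism is `(lam, mu)` semi-smooth, under no overbidding, by means of the randomized
deviations `D`: advertiser `i` with value `v i` draws a bid `y` from `D i (v i)`, a law on the
nonnegative reals that depends on nothing else, and reports `(y, A i)`. -/
def SemiSmoothVia (I : Instance N J) (T : TieBreaking N J) (lam mu : ℝ)
    (D : N → ℝ → Measure ℝ) : Prop :=
  (∀ i x, 0 ≤ x → IsProbabilityMeasure (D i x) ∧ ∀ᵐ y ∂(D i x), 0 ≤ y) ∧
  ∀ (v : N → ℝ) (A : N → Finset J) (b : N → ℝ) (S : N → Finset J), NoOverbidding v A b S →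
    (∀ i, Integrable (fun y => mixUtility I T i (v i) (Function.update b i y)
      (Function.update S i (A i))) (D i (v i))) ∧
    lam * optWelfare I v A - mu * mixWelfare I T v A b S ≤
      ∑ i, ∫ y, mixUtility I T i (v i) (Function.update b i y)
        (Function.update S i (A i)) ∂(D i (v i))

/-- The mechanism is `(lam, mu)` semi-smooth under no overbidding. -/
def SemiSmooth (I : Instance N J) (T : TieBreaking N J) (lam mu : ℝ) : Prop :=
  ∃ D : N → ℝ → Measure ℝ, SemiSmoothVia I T lam mu D

/-- The law with density `y ↦ 1 / (x - y)` on `[0, x (1 - 1/e)]` for a value `x > 0`; for the value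
`0`, where the interval is a point, the unit mass at `0`. -/
def deviationLaw (x : ℝ) : Measure ℝ :=
  open scoped Classical in
  if 0 < x then
    (volume.restrict (Set.Icc 0 (x * (1 - 1 / Real.exp 1)))).withDensity
      (fun y => ENNReal.ofReal (1 / (x - y)))
  else Measure.dirac 0

end RichAds

end

set_option linter.unusedSectionVars false

noncomputable section

namespace RichAds

/-! ### Lexicographic choice of a maximizer -/

section Pick

variable {β : Type*} {C : Finset β} {score score' : β → ℝ} {tie : β → ℕ} {p : β}

/-! Fix reports `(b, S)`, let `B` and `M` be the true welfare of the bang-per-buck and the max-value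
allocation, and put `F = B + M`, which is twice the welfare of the mechanism. The proof shows that a
deviation by `i` recovers half of `1 - 1/e` times the value of any ad `j`, minus a loss `F * w / W`
proportional to its space `w` (`val_sub_le_devUtility`). In a feasible allocation the shares `w / W`
sum to at most 1, so the total loss is at most `F`; this is where the constant 2 comes from.

Greedy allocation acts like a posted price per unit of space. If `i` bids `y` but is not given space
`w`, then the others' demand at bang-per-buck `θ = α y / w` exceeds `W - w`
(`le_greedySpace_of_demand_le`). Ads of density at least `θ` then fill enough space to give `θ (W -
w) ≤ F`, where `M` pays for the single ad that may be cut off by lack of space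
(`threshold_mul_le_welfare`). So every `y` with `α y > w F / (W - w)` wins at least `α` clicks. For
`w ≤ W/2` this critical value is at most `2 F w / W`. For `w > W/2` the max-value rule is used
instead, with critical value `M ≤ 2 F w / W`.

A GSP price never exceeds the bid, so winning `a` clicks at bid `y` is worth at least `(v - y) a`.
The density `1 / (v - y)` cancels this factor, and integrating from the critical bid `t` to `v (1 -
1/e)` gives `a (v (1 - 1/e) - t)` (`le_integral_deviationLaw`). The probability 1/2 of running the
relevant rule halves this. -/

theorem pick_eq_none (h : pick C score tie = none) : C = ∅ := by
  unfold pick at h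
  split_ifs at h with hC
  exact Finset.not_nonempty_iff_eq_empty.1 hC

theorem pick_lex (h : pick C score tie = some p) :
    p ∈ C ∧ ∀ q ∈ C, score q < score p ∨ (score q = score p ∧ tie p ≤ tie q) := by
  unfold pick at h
  split_ifs at h with hC
  have hs := Classical.choose_spec (Finset.exists_max_image C
      (fun p => (toLex (score p, OrderDual.toDual (tie p)) : ℝ ×ₗ ℕᵒᵈ)) hC)
  rw [Option.some.injEq] at h
  have h' : Classical.choose (Finset.exists_max_image C
      (fun p => (toLex (score p, OrderDual.toDual (tie p)) : ℝ ×ₗ ℕᵒᵈ)) hC) = p := h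
  rw [h'] at hs
  refine ⟨hs.1, fun q hq => ?_⟩
  have := hs.2 q hq
  rw [Prod.Lex.toLex_le_toLex] at this
  simpa using this

theorem pick_mem (h : pick C score tie = some p) : p ∈ C := (pick_lex h).1

theorem pick_le (h : pick C score tie = some p) {q : β} (hq : q ∈ C) : score q ≤ score p := by
  rcases (pick_lex h).2 q hq with h | h
  · exact h.le
  · exact h.1.le

/-- Only the order of the scores matters: injectivity of `tie` makes the lexicographic maximizer
unique. This is what reduces measurability in the bid to finitely many comparisons. -/
theorem pick_congr (ht : Function.Injective tie)
    (h : ∀ p ∈ C, ∀ q ∈ C, score p ≤ score q ↔ score' p ≤ score' q) :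
    pick C score tie = pick C score' tie := by
  cases h1 : pick C score tie with
  | none =>
    cases h2 : pick C score' tie with
    | none => rfl
    | some q => have := pick_mem h2; simp [pick_eq_none h1] at this
  | some p =>
    cases h2 : pick C score' tie with
    | none => have := pick_mem h1; simp [pick_eq_none h2] at this
    | some q =>
      obtain ⟨hp, hp'⟩ := pick_lex h1
      obtain ⟨hq, hq'⟩ := pick_lex h2
      have e1 := pick_le h1 hq
      have e2 := (h p hp q hq).2 (pick_le h2 hp)
      have e3 := (h q hq p hp).1 e1
      have t1 : tie p ≤ tie q := by
        rcases hp' q hq with h | h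
        · linarith
        · exact h.2
      have t2 : tie q ≤ tie p := by
        rcases hq' p hp with h | h
        · linarith
        · exact h.2
      rw [ht (le_antisymm t1 t2)]

end Pick

variable {N J : Type*} [Fintype N] [DecidableEq N] [Fintype J] [DecidableEq J]
variable {I : Instance N J} {T : TieBreaking N J} {b v : N → ℝ} {S A : N → Finset J}

/-! ### Bid values against true values -/

theorem val_of_mem {i : N} {j : J} (h : j ∈ S i) : val I b S i j = I.α i j * b i := if_pos h

theorem val_nonneg (hb : ∀ i, 0 ≤ b i) (i : N) (j : J) : 0 ≤ val I b S i j := by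
  unfold val
  split_ifs
  · exact mul_nonneg (I.α_nonneg i j) (hb i)
  · exact le_rfl

theorem NoOverbidding.val_le (h : NoOverbidding v A b S) {i : N} {j : J} (hj : j ∈ S i) :
    val I b S i j ≤ val I v A i j := by
  rw [val_of_mem hj, val_of_mem (h.report_sub i hj)]
  exact mul_le_mul_of_nonneg_left (h.bid_le i) (I.α_nonneg i j)

theorem NoOverbidding.value_nonneg (h : NoOverbidding v A b S) (i : N) : 0 ≤ v i :=
  (h.bid_nonneg i).trans (h.bid_le i)

theorem mem_offered {E : N → Finset J} {p : N × J} : p ∈ offered E ↔ p.2 ∈ E p.1 := by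
  simp [offered]

/-! ### The greedy algorithm -/

/-- The state of the greedy algorithm after `n` rounds. -/
def greedyState (I : Instance N J) (T : TieBreaking N J) (b : N → ℝ) (S : N → Finset J) (n : ℕ) :
    GreedyState N J :=
  (greedyStep I T b S)^[n] { rem := I.W, avail := S, space := fun _ => 0 }

theorem greedyState_succ (n : ℕ) :
    greedyState I T b S (n + 1) = greedyStep I T b S (greedyState I T b S n) :=
  Function.iterate_succ_apply' _ _ _

/-- A round of the greedy algorithm either changes nothing, when space or ads have run out, or
treats the selected pair. -/
theorem greedyStep_cases (s : GreedyState N J) :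
    (greedyStep I T b S s = s ∧ (s.rem ≤ 0 ∨ offered s.avail = ∅)) ∨
    ∃ i j, 0 < s.rem ∧ j ∈ s.avail i ∧
      (∀ k, ∀ l ∈ s.avail k, val I b S k l / I.w k l ≤ val I b S i j / I.w i j) ∧
      (∀ k, ∀ l, l ∈ (greedyStep I T b S s).avail k ↔
        l ∈ s.avail k ∧ (k = i → I.w i j < I.w i l)) ∧
      ((I.w i j - s.space i ≤ s.rem ∧
        (greedyStep I T b S s).rem = s.rem - (I.w i j - s.space i) ∧
        (greedyStep I T b S s).space = Function.update s.space i (I.w i j)) ∨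
       (s.rem < I.w i j - s.space i ∧
        (greedyStep I T b S s).rem = 0 ∧
        (greedyStep I T b S s).space = Function.update s.space i (s.space i + s.rem))) := by
  classical
  by_cases hr : s.rem ≤ 0
  · left
    exact ⟨by simp [greedyStep, hr], Or.inl hr⟩
  cases hp : pick (offered s.avail) (fun p => val I b S p.1 p.2 / I.w p.1 p.2) T.bpb with
  | none =>
    left
    exact ⟨by simp [greedyStep, hp], Or.inr (pick_eq_none hp)⟩
  | some p =>
    right
    obtain ⟨i, j⟩ := p
    refine ⟨i, j, not_le.1 hr, mem_offered.1 (pick_mem hp),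
      fun k l hl => pick_le hp (q := (k, l)) (mem_offered.2 hl), ?_, ?_⟩
    · have : (greedyStep I T b S s).avail =
          Function.update s.avail i ((s.avail i).filter fun k => I.w i j < I.w i k) := by
        simp only [greedyStep, hr, if_false, hp]
        split_ifs <;> simp
      intro k l
      rw [this]
      by_cases hk : k = i
      · subst hk; simp
      · simp [hk]
    · by_cases hw : I.w i j - s.space i ≤ s.rem
      · left
        refine ⟨hw, ?_, ?_⟩ <;> simp only [greedyStep, hr, if_false, hp, if_pos hw]
      · right
        refine ⟨not_le.1 hw, ?_, ?_⟩ <;> simp only [greedyStep, hr, if_false, hp, if_neg hw]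

/-- The invariants of the greedy algorithm. -/
structure GreedyInv (I : Instance N J) (S : N → Finset J) (s : GreedyState N J) : Prop where
  rem_nonneg : 0 ≤ s.rem
  rem_add : s.rem + ∑ k, s.space k = I.W
  avail_sub : ∀ k, s.avail k ⊆ S k
  avail_or : 0 < s.rem → ∀ k, ∀ l ∈ S k, l ∈ s.avail k ∨ I.w k l ≤ s.space k
  lt_avail : 0 < s.rem → ∀ k, ∀ l ∈ s.avail k, s.space k < I.w k l

theorem sum_update_eq (f : N → ℝ) (i : N) (x : ℝ) :
    ∑ k, Function.update f i x k = ∑ k, f k + (x - f i) := by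
  rw [Finset.sum_update_of_mem (Finset.mem_univ i),
    ← Finset.add_sum_erase _ f (Finset.mem_univ i), Finset.sdiff_singleton_eq_erase]
  ring

/-- The clauses on available ads are claimed only while space remains: the last, truncated increase
discards ads that need not fit. -/
theorem greedyInv_step {s : GreedyState N J} (h : GreedyInv I S s) :
    GreedyInv I S (greedyStep I T b S s) := by
  rcases greedyStep_cases (I := I) (T := T) (b := b) (S := S) s with
    ⟨e, -⟩ | ⟨i, j, hr, hj, -, hav, hc⟩
  · rwa [e]
  have hlt := h.lt_avail hr i j hj
  have hsub : ∀ k, (greedyStep I T b S s).avail k ⊆ S k := fun k l hl =>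
    h.avail_sub k ((hav k l).1 hl).1
  rcases hc with ⟨hw, hrem, hsp⟩ | ⟨hw, hrem, hsp⟩
  · refine ⟨by rw [hrem]; linarith, ?_, hsub, fun _ k l hl => ?_, fun _ k l hl => ?_⟩
    · rw [hrem, hsp, sum_update_eq, ← h.rem_add]; ring
    · rw [hav, hsp]
      by_cases hk : k = i
      · subst hk
        rw [Function.update_self]
        rcases lt_or_ge (I.w k j) (I.w k l) with h1 | h1
        · rcases h.avail_or hr k l hl with h2 | h2
          · exact Or.inl ⟨h2, fun _ => h1⟩
          · linarith
        · exact Or.inr h1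
      · rw [Function.update_of_ne hk]
        rcases h.avail_or hr k l hl with h2 | h2
        · exact Or.inl ⟨h2, fun h => absurd h hk⟩
        · exact Or.inr h2
    · rw [hav] at hl
      rw [hsp]
      by_cases hk : k = i
      · subst hk
        rw [Function.update_self]
        exact hl.2 rfl
      · rw [Function.update_of_ne hk]
        exact h.lt_avail hr k l hl.1
  · refine ⟨hrem.ge, ?_, hsub, fun h0 => absurd h0 (by simp [hrem]),
      fun h0 => absurd h0 (by simp [hrem])⟩
    rw [hrem, hsp, sum_update_eq, ← h.rem_add]; ring

theorem greedyInv_state (n : ℕ) : GreedyInv I S (greedyState I T b S n) := by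
  induction n with
  | zero =>
    exact ⟨I.W_pos.le, by simp [greedyState], fun _ => subset_rfl, fun _ _ _ hl => Or.inl hl,
      fun _ k l _ => I.w_pos k l⟩
  | succ n ih => rw [greedyState_succ]; exact greedyInv_step ih

theorem greedyStep_space_mono {s : GreedyState N J} (h : GreedyInv I S s) (k : N) :
    s.space k ≤ (greedyStep I T b S s).space k := by
  rcases greedyStep_cases (I := I) (T := T) (b := b) (S := S) s with
    ⟨e, -⟩ | ⟨i, j, hr, hj, -, hav, hc⟩
  · rw [e]
  have hlt := h.lt_avail hr i j hj
  rcases hc with ⟨hw, hrem, hsp⟩ | ⟨hw, hrem, hsp⟩ <;> rw [hsp] <;> by_cases hk : k = i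
  · subst hk; rw [Function.update_self]; exact hlt.le
  · rw [Function.update_of_ne hk]
  · subst hk; rw [Function.update_self]; linarith
  · rw [Function.update_of_ne hk]

/-- An active round discards at least the selected pair, because the filter on spaces is strict. -/
theorem greedyState_progress (n : ℕ) :
    (greedyState I T b S n).rem ≤ 0 ∨ offered (greedyState I T b S n).avail = ∅ ∨
      (offered (greedyState I T b S n).avail).card + n ≤ Fintype.card (N × J) := by
  induction n with
  | zero => exact Or.inr (Or.inr (Finset.card_le_univ _))
  | succ n ih =>
    rw [greedyState_succ]
    set s := greedyState I T b S n
    rcases greedyStep_cases (I := I) (T := T) (b := b) (S := S) s with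
      ⟨e, h⟩ | ⟨i, j, hr, hj, -, hav, -⟩
    · rw [e]
      rcases h with h | h
      · exact Or.inl h
      · exact Or.inr (Or.inl h)
    · right; right
      have hlt : (offered (greedyStep I T b S s).avail).card < (offered s.avail).card := by
        apply Finset.card_lt_card
        rw [Finset.ssubset_iff_of_subset]
        · refine ⟨(i, j), mem_offered.2 hj, fun hc => ?_⟩
          exact lt_irrefl _ (((hav i j).1 (mem_offered.1 hc)).2 rfl)
        · intro p hp
          exact mem_offered.2 ((hav _ _).1 (mem_offered.1 hp)).1
      rcases ih with ih | ih | ih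
      · linarith
      · have := (mem_offered (p := (i, j))).2 hj; simp [ih] at this
      · omega

/-- When the greedy algorithm is over, every reported ad fits or all space is allotted. -/
theorem greedySpace_final :
    (∀ k, ∀ l ∈ S k, I.w k l ≤ greedySpace I T b S k) ∨
      (greedyState I T b S (Fintype.card (N × J))).rem = 0 := by
  have hinv := greedyInv_state (I := I) (T := T) (b := b) (S := S) (Fintype.card (N × J))
  rcases hinv.rem_nonneg.eq_or_lt with h | h
  · exact Or.inr h.symm
  left
  intro k l hl
  have he : offered (greedyState I T b S (Fintype.card (N × J))).avail = ∅ := by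
    rcases greedyState_progress (I := I) (T := T) (b := b) (S := S) (Fintype.card (N × J)) with
      h' | h' | h'
    · linarith
    · exact h'
    · exact Finset.card_eq_zero.1 (by omega)
  rcases hinv.avail_or h k l hl with h' | h'
  · have := (mem_offered (p := (k, l))).2 h'
    rw [he] at this
    exact absurd this (Finset.notMem_empty _)
  · exact h'

theorem sum_greedySpace (h : (greedyState I T b S (Fintype.card (N × J))).rem = 0) :
    ∑ k, greedySpace I T b S k = I.W := by
  have := (greedyInv_state (I := I) (T := T) (b := b) (S := S) (Fintype.card (N × J))).rem_add
  rwa [h, zero_add] at this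

/-! ### Demand at a bang-per-buck threshold -/

/-- The largest space of an ad of `k` with bang-per-buck at least `θ` (`0` if there is none). -/
def demand (I : Instance N J) (b : N → ℝ) (S : N → Finset J) (θ : ℝ) (k : N) : ℝ :=
  open scoped Classical in
  (insert 0 (((S k).filter fun j => θ ≤ val I b S k j / I.w k j).image (I.w k))).max'
    (Finset.insert_nonempty _ _)

theorem demand_nonneg (θ : ℝ) (k : N) : 0 ≤ demand I b S θ k :=
  Finset.le_max' _ _ (Finset.mem_insert_self _ _)

theorem le_demand {θ : ℝ} {k : N} {j : J} (hj : j ∈ S k) (h : θ ≤ val I b S k j / I.w k j) :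
    I.w k j ≤ demand I b S θ k := by
  classical
  refine Finset.le_max' _ _ (Finset.mem_insert_of_mem (Finset.mem_image_of_mem _ ?_))
  simp [hj, h]

theorem demand_eq (θ : ℝ) (k : N) : demand I b S θ k = 0 ∨
    ∃ j ∈ S k, θ ≤ val I b S k j / I.w k j ∧ demand I b S θ k = I.w k j := by
  classical
  have := Finset.max'_mem (insert 0 (((S k).filter fun j =>
    θ ≤ val I b S k j / I.w k j).image (I.w k))) (Finset.insert_nonempty _ _)
  rcases Finset.mem_insert.1 this with h | h
  · left; unfold demand; convert h
  · right
    obtain ⟨j, hj, e⟩ := Finset.mem_image.1 h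
    rw [Finset.mem_filter] at hj
    refine ⟨j, hj.1, hj.2, ?_⟩
    rw [e]; unfold demand; congr!

/-- Used to see that a deviation of `i` leaves the demand of all others unchanged. -/
theorem demand_congr {b' : N → ℝ} {S' : N → Finset J} {k : N} (hb : b k = b' k) (hS : S k = S' k)
    (θ : ℝ) : demand I b S θ k = demand I b' S' θ k := by
  have hv : ∀ j, val I b S k j = val I b' S' k j := fun j => by simp only [val, hb, hS]
  apply le_antisymm
  · rcases demand_eq (I := I) (b := b) (S := S) θ k with e | ⟨j, hj, h, e⟩
    · rw [e]; exact demand_nonneg θ k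
    · rw [e]; exact le_demand (hS ▸ hj) (hv j ▸ h)
  · rcases demand_eq (I := I) (b := b') (S := S') θ k with e | ⟨j, hj, h, e⟩
    · rw [e]; exact demand_nonneg θ k
    · rw [e]; exact le_demand (hS ▸ hj) ((hv j).symm ▸ h)

/-- An ad gets its space if the demand of the others at its bang-per-buck leaves room for it. -/
theorem le_greedySpace_of_demand_le {i : N} {j : J} (hj : j ∈ S i)
    (h : ∑ k ∈ Finset.univ.erase i, demand I b S (val I b S i j / I.w i j) k ≤ I.W - I.w i j) :
    I.w i j ≤ greedySpace I T b S i := by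
  set θ := val I b S i j / I.w i j with hθ
  have key : ∀ n, (∀ k ≠ i, (greedyState I T b S n).space k ≤ demand I b S θ k) ∨
      I.w i j ≤ (greedyState I T b S n).space i := by
    intro n
    induction n with
    | zero => exact Or.inl fun k _ => demand_nonneg _ _
    | succ n ih =>
      rw [greedyState_succ]
      have hinv := greedyInv_state (I := I) (T := T) (b := b) (S := S) n
      set s := greedyState I T b S n
      by_cases hs : I.w i j ≤ s.space i
      · exact Or.inr (hs.trans (greedyStep_space_mono hinv i))
      have ih' := ih.resolve_right hs
      rcases greedyStep_cases (I := I) (T := T) (b := b) (S := S) s with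
        ⟨e, -⟩ | ⟨i', j', hr, hj', hmax, hav, hc⟩
      · rw [e]; exact ih
      left
      intro k hk
      -- While `i` holds less than `w i j`, the ad `j` is still available, so the selected pair has
      -- bang-per-buck at least `θ`. Ties count as demand, so priorities play no role.
      have hθ' := hmax i j ((hinv.avail_or hr i j hj).resolve_right hs)
      have hle := le_demand (hinv.avail_sub i' hj') hθ'
      rcases hc with ⟨hw, -, hsp⟩ | ⟨hw, -, hsp⟩ <;> rw [hsp] <;> by_cases hk' : k = i'
      · subst hk'; rw [Function.update_self]; exact hle
      · rw [Function.update_of_ne hk']; exact ih' k hk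
      · subst hk'; rw [Function.update_self]; linarith
      · rw [Function.update_of_ne hk']; exact ih' k hk
  rcases greedySpace_final (I := I) (T := T) (b := b) (S := S) with hf | hf
  · exact hf i j hj
  rcases key (Fintype.card (N × J)) with hk | hk
  · have hsum := sum_greedySpace hf
    rw [← Finset.add_sum_erase _ _ (Finset.mem_univ i)] at hsum
    have : ∑ k ∈ Finset.univ.erase i, greedySpace I T b S k ≤
        ∑ k ∈ Finset.univ.erase i, demand I b S θ k :=
      Finset.sum_le_sum fun k hk' => hk k (Finset.ne_of_mem_erase hk')
    linarith
  · exact hk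

/-- Either the greedy allocation serves all demand at threshold `θ`, or it fills the whole space,
except for the last ad, with ads of bang-per-buck at least `θ`. -/
theorem greedySpace_threshold (θ : ℝ) :
    (∀ k, demand I b S θ k ≤ greedySpace I T b S k) ∨
    ∑ k, greedySpace I T b S k = I.W ∧
      ∃ i, ∃ j ∈ S i, θ ≤ val I b S i j / I.w i j ∧ greedySpace I T b S i ≤ I.w i j ∧
        ∀ k ≠ i, greedySpace I T b S k = 0 ∨
          ∃ l ∈ S k, θ ≤ val I b S k l / I.w k l ∧ I.w k l = greedySpace I T b S k := by
  -- Invariant: demand at `θ` is served; or space remains and every ad held has density at least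
  -- `θ`; or space is exhausted and only the last advertiser treated may hold a truncated amount.
  have key : ∀ n, (∀ k, ∀ l ∈ S k, θ ≤ val I b S k l / I.w k l →
        I.w k l ≤ (greedyState I T b S n).space k) ∨
      (0 < (greedyState I T b S n).rem ∧ ∀ k, (greedyState I T b S n).space k = 0 ∨
          ∃ l ∈ S k, θ ≤ val I b S k l / I.w k l ∧ I.w k l = (greedyState I T b S n).space k) ∨
      ((greedyState I T b S n).rem = 0 ∧ ∃ i, ∃ j ∈ S i, θ ≤ val I b S i j / I.w i j ∧
        (greedyState I T b S n).space i ≤ I.w i j ∧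
        ∀ k ≠ i, (greedyState I T b S n).space k = 0 ∨
          ∃ l ∈ S k, θ ≤ val I b S k l / I.w k l ∧
            I.w k l = (greedyState I T b S n).space k) := by
    intro n
    induction n with
    | zero => exact Or.inr (Or.inl ⟨I.W_pos, fun k => Or.inl rfl⟩)
    | succ n ih =>
      rw [greedyState_succ]
      have hinv := greedyInv_state (I := I) (T := T) (b := b) (S := S) n
      have hinv' := greedyInv_step (T := T) (b := b) hinv
      set s := greedyState I T b S n
      by_cases hs : ∀ k, ∀ l ∈ S k, θ ≤ val I b S k l / I.w k l → I.w k l ≤ s.space k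
      · exact Or.inl fun k l hl h => (hs k l hl h).trans (greedyStep_space_mono hinv k)
      rcases greedyStep_cases (I := I) (T := T) (b := b) (S := S) s with
        ⟨e, -⟩ | ⟨i, j, hr, hj, hmax, hav, hc⟩
      · rw [e]; exact ih
      right
      rcases ih with ih | ⟨-, ih⟩ | ⟨ih, -⟩
      · exact absurd ih hs
      swap
      · linarith
      push Not at hs
      obtain ⟨k₀, l₀, hl₀, hθ₀, hlt⟩ := hs
      -- Some ad of density at least `θ` does not fit yet, hence is available, and the selected pair
      -- is at least as dense.
      have hθ := hθ₀.trans (hmax k₀ l₀ ((hinv.avail_or hr k₀ l₀ hl₀).resolve_right hlt.not_ge))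
      have hjS := hinv.avail_sub i hj
      have hle : (greedyStep I T b S s).space i ≤ I.w i j := by
        rcases hc with ⟨hw, -, hsp⟩ | ⟨hw, -, hsp⟩ <;> rw [hsp, Function.update_self]
        linarith
      have hne : ∀ k ≠ i, (greedyStep I T b S s).space k = s.space k := by
        intro k hk
        rcases hc with ⟨hw, -, hsp⟩ | ⟨hw, -, hsp⟩ <;> rw [hsp, Function.update_of_ne hk]
      rcases hinv'.rem_nonneg.eq_or_lt with h0 | h0
      · refine Or.inr ⟨h0.symm, i, j, hjS, hθ, hle, fun k hk => ?_⟩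
        rw [hne k hk]; exact ih k
      · refine Or.inl ⟨h0, fun k => ?_⟩
        by_cases hk : k = i
        · subst hk
          rcases hc with ⟨hw, -, hsp⟩ | ⟨hw, h1, hsp⟩
          · exact Or.inr ⟨j, hjS, hθ, by rw [hsp, Function.update_self]⟩
          · linarith
        · rw [hne k hk]; exact ih k
  have hall : (∀ k, ∀ l ∈ S k, θ ≤ val I b S k l / I.w k l →
      I.w k l ≤ greedySpace I T b S k) → ∀ k, demand I b S θ k ≤ greedySpace I T b S k := by
    intro h k
    have h0 : 0 ≤ greedySpace I T b S k := by
      have : ∀ n, 0 ≤ (greedyState I T b S n).space k := by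
        intro n
        induction n with
        | zero => exact le_rfl
        | succ n ih =>
          rw [greedyState_succ]
          exact ih.trans (greedyStep_space_mono (greedyInv_state n) k)
      exact this _
    rcases demand_eq (I := I) (b := b) (S := S) θ k with e | ⟨j, hj, hθ, e⟩
    · rwa [e]
    · rw [e]; exact h k j hj hθ
  rcases key (Fintype.card (N × J)) with h | ⟨h, -⟩ | ⟨h, h'⟩
  · exact Or.inl (hall h)
  · rcases greedySpace_final (I := I) (T := T) (b := b) (S := S) with hf | hf
    · exact Or.inl (hall fun k l hl _ => hf k l hl)
    · linarith
  · exact Or.inr ⟨sum_greedySpace h, h'⟩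

/-! ### Welfare of the two rules -/

theorem elim_val_nonneg (hv : ∀ i, 0 ≤ v i) (x : Allocation N J) (i : N) :
    0 ≤ (x i).elim 0 (val I v A i) := by
  cases x i with
  | none => exact le_rfl
  | some j => exact val_nonneg hv i j

theorem welfare_nonneg (hv : ∀ i, 0 ≤ v i) (x : Allocation N J) : 0 ≤ welfare I v A x :=
  Finset.sum_nonneg fun i _ => elim_val_nonneg hv x i

theorem bpbRule_spec {k : N} {j : J} (hj : j ∈ S k) (hw : I.w k j ≤ greedySpace I T b S k) :
    ∃ l ∈ S k, bpbRule I T b S k = some l ∧ val I b S k j ≤ val I b S k l := by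
  classical
  have hmem : j ∈ (S k).filter fun j => I.w k j ≤ greedySpace I T b S k := by simp [hj, hw]
  unfold bpbRule
  cases h : pick ((S k).filter fun j => I.w k j ≤ greedySpace I T b S k) (val I b S k)
      (fun j => T.post (k, j)) with
  | none => have := pick_eq_none h; rw [this] at hmem; simp at hmem
  | some l => exact ⟨l, (Finset.mem_filter.1 (pick_mem h)).1, rfl, pick_le h hmem⟩

/-- Post-processing maximizes the bid value, and no overbidding bounds the bid value of the ad shown
by its true value. -/
theorem val_le_bpbRule (h : NoOverbidding v A b S) {k : N} {j : J} (hj : j ∈ S k)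
    (hw : I.w k j ≤ greedySpace I T b S k) :
    val I b S k j ≤ (bpbRule I T b S k).elim 0 (val I v A k) := by
  obtain ⟨l, hl, e, hle⟩ := bpbRule_spec hj hw
  rw [e]
  exact hle.trans (h.val_le hl)

theorem val_le_welfare_maxRule (h : NoOverbidding v A b S) {k : N} {j : J} (hj : j ∈ S k) :
    val I b S k j ≤ welfare I v A (maxRule I T b S) := by
  have hmem : (k, j) ∈ offered S := mem_offered.2 hj
  cases hp : pick (offered S) (fun p => val I b S p.1 p.2) T.maxv with
  | none => have := pick_eq_none hp; rw [this] at hmem; simp at hmem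
  | some p =>
    have h1 : val I b S k j ≤ val I b S p.1 p.2 := pick_le hp hmem
    have h2 : val I b S p.1 p.2 ≤ val I v A p.1 p.2 := h.val_le (mem_offered.1 (pick_mem hp))
    refine (h1.trans h2).trans ?_
    have h3 : (maxRule I T b S p.1).elim 0 (val I v A p.1) = val I v A p.1 p.2 := by
      simp [maxRule, hp]
    rw [← h3]
    exact Finset.single_le_sum (f := fun i => (maxRule I T b S i).elim 0 (val I v A i))
      (fun i _ => elim_val_nonneg h.value_nonneg _ i) (Finset.mem_univ p.1)

/-- The bang-per-buck and the max-value allocation together have at least the welfare of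
`θ` per unit of space, up to the demand at threshold `θ`. -/
theorem threshold_mul_le_welfare (h : NoOverbidding v A b S) {θ : ℝ} (hθ : 0 ≤ θ) :
    θ * min I.W (∑ k, demand I b S θ k) ≤
      welfare I v A (bpbRule I T b S) + welfare I v A (maxRule I T b S) := by
  have key : ∀ k, ∀ j ∈ S k, θ ≤ val I b S k j / I.w k j → θ * I.w k j ≤ val I b S k j :=
    fun k j _ h => (le_div_iff₀ (I.w_pos k j)).1 h
  have hmax := welfare_nonneg (I := I) (A := A) h.value_nonneg (maxRule I T b S)
  rcases greedySpace_threshold (I := I) (T := T) (b := b) (S := S) θ with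
    hd | ⟨hsum, i, j, hj, hji, hle, hk⟩
  · have : θ * ∑ k, demand I b S θ k ≤ welfare I v A (bpbRule I T b S) := by
      rw [Finset.mul_sum]
      refine Finset.sum_le_sum fun k _ => ?_
      rcases demand_eq (I := I) (b := b) (S := S) θ k with e | ⟨l, hl, hlθ, e⟩
      · rw [e, mul_zero]; exact elim_val_nonneg h.value_nonneg _ k
      · have hd' := hd k
        rw [e] at hd' ⊢
        exact (key k l hl hlθ).trans (val_le_bpbRule h hl hd')
    have h2 := mul_le_mul_of_nonneg_left (min_le_right I.W (∑ k, demand I b S θ k)) hθ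
    linarith
  · have h1 : θ * ∑ k ∈ Finset.univ.erase i, greedySpace I T b S k ≤
        welfare I v A (bpbRule I T b S) := by
      unfold welfare
      rw [Finset.mul_sum, ← Finset.add_sum_erase _ _ (Finset.mem_univ i)]
      refine le_add_of_nonneg_of_le (elim_val_nonneg h.value_nonneg _ i)
        (Finset.sum_le_sum fun k hk' => ?_)
      rcases hk k (Finset.ne_of_mem_erase hk') with e | ⟨l, hl, hlθ, e⟩
      · rw [e, mul_zero]; exact elim_val_nonneg h.value_nonneg _ k
      · rw [← e]; exact (key k l hl hlθ).trans (val_le_bpbRule h hl e.le)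
    -- The possibly truncated space of `i` is charged to the whole ad `j`, whose bid value the
    -- max-value allocation dominates.
    have h2 : θ * greedySpace I T b S i ≤ welfare I v A (maxRule I T b S) :=
      ((mul_le_mul_of_nonneg_left hle hθ).trans (key i j hj hji)).trans
        (val_le_welfare_maxRule h hj)
    have h3 := mul_le_mul_of_nonneg_left (min_le_left I.W (∑ k, demand I b S θ k)) hθ
    rw [← Finset.add_sum_erase _ _ (Finset.mem_univ i)] at hsum
    have h4 : θ * I.W = θ * greedySpace I T b S i +
        θ * ∑ k ∈ Finset.univ.erase i, greedySpace I T b S k := by rw [← hsum, mul_add]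
    linarith

/-! ### Clicks after a deviation -/

/-- The bids when `i` deviates to `y`. -/
abbrev devBid (b : N → ℝ) (i : N) (y : ℝ) : N → ℝ := Function.update b i y

/-- The reported sets when `i` reports its true set. -/
abbrev devSet (S A : N → Finset J) (i : N) : N → Finset J := Function.update S i (A i)

/-- The bound on `y` says `F < θ * (W - w)` for the density `θ` of `j` at bid `y`. If the others'
demand left no room for `j`, `threshold_mul_le_welfare` would give the opposite inequality. -/
theorem le_clicks_bpbRule {i : N} {j : J} {y : ℝ} (h : NoOverbidding v A b S) (hj : j ∈ A i)
    (hα : 0 < I.α i j) (hw : I.w i j < I.W)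
    (hy : I.w i j * (welfare I v A (bpbRule I T b S) + welfare I v A (maxRule I T b S)) /
      (I.W - I.w i j) / I.α i j < y) :
    I.α i j ≤ clicks I (bpbRule I T (devBid b i y) (devSet S A i)) i := by
  set F := welfare I v A (bpbRule I T b S) + welfare I v A (maxRule I T b S) with hF
  have hF0 : 0 ≤ F := add_nonneg (welfare_nonneg h.value_nonneg _) (welfare_nonneg h.value_nonneg _)
  have hd : 0 < I.W - I.w i j := sub_pos.2 hw
  have hwp := I.w_pos i j
  have hy0 : 0 < y := lt_of_le_of_lt (by positivity) hy
  have hj' : j ∈ devSet S A i i := by simpa [devSet] using hj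
  have hval : ∀ l ∈ devSet S A i i, val I (devBid b i y) (devSet S A i) i l = I.α i l * y := by
    intro l hl; rw [val_of_mem hl]; simp [devBid]
  have hfit : I.w i j ≤ greedySpace I T (devBid b i y) (devSet S A i) i := by
    apply le_greedySpace_of_demand_le hj'
    rw [hval j hj']
    set θ := I.α i j * y / I.w i j with hθ
    have hθ0 : 0 ≤ θ := by positivity
    by_contra hc
    push Not at hc
    have e : ∑ k ∈ Finset.univ.erase i, demand I (devBid b i y) (devSet S A i) θ k =
        ∑ k ∈ Finset.univ.erase i, demand I b S θ k :=
      Finset.sum_congr rfl fun k hk => demand_congr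
        (Function.update_of_ne (Finset.ne_of_mem_erase hk) _ _)
        (Function.update_of_ne (Finset.ne_of_mem_erase hk) _ _) θ
    rw [e] at hc
    have h1 : I.W - I.w i j ≤ min I.W (∑ k, demand I b S θ k) := by
      refine le_min (by linarith) ?_
      rw [← Finset.add_sum_erase _ _ (Finset.mem_univ i)]
      have := demand_nonneg (I := I) (b := b) (S := S) θ i
      linarith
    have h2 := threshold_mul_le_welfare (I := I) (T := T) h hθ0
    have h3 := mul_le_mul_of_nonneg_left h1 hθ0
    have h4 : F < θ * (I.W - I.w i j) := by
      rw [div_lt_iff₀ hα, div_lt_iff₀ hd] at hy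
      rw [hθ, div_mul_eq_mul_div, lt_div_iff₀ hwp]
      linarith
    linarith
  obtain ⟨l, hl, e, hle⟩ := bpbRule_spec hj' hfit
  rw [hval j hj', hval l hl] at hle
  rw [clicks, e]
  -- Bid values of `i` are clicks times the common factor `y > 0`, so a higher bid value means at
  -- least as many clicks.
  exact le_of_mul_le_mul_right hle hy0

/-- The welfare of the max-value allocation dominates every bid value at `(b, S)`, so `α * y` beats
all other advertisers. -/
theorem le_clicks_maxRule {i : N} {j : J} {y : ℝ} (h : NoOverbidding v A b S) (hj : j ∈ A i)
    (hα : 0 < I.α i j) (hy : welfare I v A (maxRule I T b S) / I.α i j < y) :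
    I.α i j ≤ clicks I (maxRule I T (devBid b i y) (devSet S A i)) i := by
  have hM0 := welfare_nonneg (I := I) (A := A) h.value_nonneg (maxRule I T b S)
  have hy0 : 0 < y := lt_of_le_of_lt (by positivity) hy
  have hj' : j ∈ devSet S A i i := by simpa [devSet] using hj
  have hval : ∀ l ∈ devSet S A i i, val I (devBid b i y) (devSet S A i) i l = I.α i l * y := by
    intro l hl; rw [val_of_mem hl]; simp [devBid]
  have hmem : (i, j) ∈ offered (devSet S A i) := mem_offered.2 hj'
  cases hp : pick (offered (devSet S A i))
      (fun p => val I (devBid b i y) (devSet S A i) p.1 p.2) T.maxv with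
  | none => have := pick_eq_none hp; rw [this] at hmem; simp at hmem
  | some p =>
    obtain ⟨k, l⟩ := p
    have hle : val I (devBid b i y) (devSet S A i) i j ≤
      val I (devBid b i y) (devSet S A i) k l := pick_le hp hmem
    have hl : l ∈ devSet S A i k := mem_offered.1 (pick_mem hp)
    rw [hval j hj'] at hle
    by_cases hk : k = i
    · subst hk
      rw [hval l hl] at hle
      have : clicks I (maxRule I T (devBid b k y) (devSet S A k)) k = I.α k l := by
        simp only [clicks, maxRule, hp, if_true, Option.elim_some]
      rw [this]
      exact le_of_mul_le_mul_right hle hy0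
    · exfalso
      have hl' : l ∈ S k := by simpa [devSet, hk] using hl
      have e : val I (devBid b i y) (devSet S A i) k l = val I b S k l := by
        rw [val_of_mem hl, val_of_mem hl']; simp [devBid, hk]
      rw [e] at hle
      have := val_le_welfare_maxRule (I := I) (T := T) h hl'
      rw [div_lt_iff₀ hα] at hy
      linarith

/-! ### Dependence of the allocation on the bid -/

theorem greedyStep_congr {b' : N → ℝ}
    (h : ∀ p q : N × J, val I b S p.1 p.2 / I.w p.1 p.2 ≤ val I b S q.1 q.2 / I.w q.1 q.2 ↔
      val I b' S p.1 p.2 / I.w p.1 p.2 ≤ val I b' S q.1 q.2 / I.w q.1 q.2) :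
    greedyStep I T b S = greedyStep I T b' S := by
  funext s
  have : pick (offered s.avail) (fun p => val I b S p.1 p.2 / I.w p.1 p.2) T.bpb =
      pick (offered s.avail) (fun p => val I b' S p.1 p.2 / I.w p.1 p.2) T.bpb :=
    pick_congr T.bpb_inj fun p _ q _ => h p q
  simp only [greedyStep, this]

theorem bpbRule_congr {b' : N → ℝ}
    (h : ∀ p q : N × J, val I b S p.1 p.2 / I.w p.1 p.2 ≤ val I b S q.1 q.2 / I.w q.1 q.2 ↔
      val I b' S p.1 p.2 / I.w p.1 p.2 ≤ val I b' S q.1 q.2 / I.w q.1 q.2)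
    (h' : ∀ p q : N × J, val I b S p.1 p.2 ≤ val I b S q.1 q.2 ↔
      val I b' S p.1 p.2 ≤ val I b' S q.1 q.2) :
    bpbRule I T b S = bpbRule I T b' S := by
  funext i
  unfold bpbRule greedySpace
  rw [greedyStep_congr h]
  exact pick_congr (fun j l e => (Prod.ext_iff.1 (T.post_inj e)).2) fun j _ l _ => h' (i, j) (i, l)

theorem maxRule_congr {b' : N → ℝ}
    (h' : ∀ p q : N × J, val I b S p.1 p.2 ≤ val I b S q.1 q.2 ↔
      val I b' S p.1 p.2 ≤ val I b' S q.1 q.2) :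
    maxRule I T b S = maxRule I T b' S := by
  funext i
  have : pick (offered S) (fun p => val I b S p.1 p.2) T.maxv =
      pick (offered S) (fun p => val I b' S p.1 p.2) T.maxv :=
    pick_congr T.maxv_inj fun p _ q _ => h' p q
  simp only [maxRule, this]

/-- A function of a real variable is measurable if it depends only on the outcomes of finitely many
comparisons of measurable functions of that variable. -/
theorem measurable_of_comparisons {P : Type*} [Finite P] {γ : Type*} [MeasurableSpace γ] [Nonempty γ]
    {f₁ f₂ : P → ℝ → ℝ} (h₁ : ∀ p, Measurable (f₁ p)) (h₂ : ∀ p, Measurable (f₂ p))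
    {F : ℝ → γ} (hF : ∀ y y', (∀ p, f₁ p y ≤ f₂ p y ↔ f₁ p y' ≤ f₂ p y') → F y = F y') :
    Measurable F := by
  have hR : Measurable fun y (p : P) => f₁ p y ≤ f₂ p y :=
    measurable_pi_iff.2 fun p => measurableSet_setOfPred.1 (measurableSet_le (h₁ p) (h₂ p))
  have hfac : Function.FactorsThrough F fun y (p : P) => f₁ p y ≤ f₂ p y :=
    fun y y' h => hF y y' fun p => iff_of_eq (congrFun h p)
  -- The truth values form a finite discrete space, on which every function is measurable.
  obtain ⟨g, rfl⟩ := (Function.factorsThrough_iff F).1 hfac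
  exact (Measurable.of_discrete (f := g)).comp hR

theorem measurable_val_update (i : N) (p : N × J) :
    Measurable fun y => val I (Function.update b i y) S p.1 p.2 := by
  unfold val
  split_ifs
  · refine Measurable.const_mul ?_ _
    exact (measurable_pi_apply p.1).comp (measurable_update b)
  · exact measurable_const

theorem measurable_comp_bpbRule {γ : Type*} [MeasurableSpace γ] [Nonempty γ] (i : N)
    (G : Allocation N J → γ) : Measurable fun y => G (bpbRule I T (Function.update b i y) S) := by
  -- The Boolean selects comparisons of bang-per-buck (`true`) or of bid values (`false`).
  refine measurable_of_comparisons (P := Bool × (N × J) × (N × J))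
    (f₁ := fun p y => val I (Function.update b i y) S p.2.1.1 p.2.1.2 /
      (if p.1 then I.w p.2.1.1 p.2.1.2 else 1))
    (f₂ := fun p y => val I (Function.update b i y) S p.2.2.1 p.2.2.2 /
      (if p.1 then I.w p.2.2.1 p.2.2.2 else 1))
    (fun p => (measurable_val_update i p.2.1).div_const _)
    (fun p => (measurable_val_update i p.2.2).div_const _) fun y y' h => ?_
  refine congrArg G (bpbRule_congr (fun p q => ?_) fun p q => ?_)
  · simpa using h (true, p, q)
  · simpa using h (false, p, q)

theorem measurable_comp_maxRule {γ : Type*} [MeasurableSpace γ] [Nonempty γ] (i : N)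
    (G : Allocation N J → γ) : Measurable fun y => G (maxRule I T (Function.update b i y) S) := by
  refine measurable_of_comparisons (P := (N × J) × (N × J))
    (f₁ := fun p y => val I (Function.update b i y) S p.1.1 p.1.2)
    (f₂ := fun p y => val I (Function.update b i y) S p.2.1 p.2.2)
    (fun p => measurable_val_update i p.1)
    (fun p => measurable_val_update i p.2) fun y y' h => ?_
  exact congrArg G (maxRule_congr fun p q => h (p, q))

/-! ### GSP utility -/

theorem clicks_nonneg (x : Allocation N J) (i : N) : 0 ≤ clicks I x i := by
  unfold clicks
  cases x i with
  | none => exact le_rfl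
  | some j => exact I.α_nonneg i j

/-- The bid `y` itself belongs to the set whose infimum is the cost per click. -/
theorem le_gspUtility (x : AllocationRule N J) (i : N) (vi y : ℝ) (hy : 0 ≤ y) :
    (vi - y) * clicks I (x (Function.update b i y) S) i ≤
      gspUtility I x i vi (Function.update b i y) S := by
  have hc : gspCpc I x (Function.update b i y) S i ≤ y :=
    csInf_le ⟨0, fun t ht => ht.1⟩ ⟨hy, by rw [Function.update_idem]⟩
  have := mul_le_mul_of_nonneg_left hc (clicks_nonneg (I := I) (x (Function.update b i y) S) i)
  unfold gspUtility gspPayment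
  linarith

/-- The GSP utility of `i` at the bid where its allocation is `a`. -/
def allocUtility (I : Instance N J) (x : AllocationRule N J) (b : N → ℝ) (S : N → Finset J) (i : N)
    (vi : ℝ) (a : Allocation N J) : ℝ :=
  vi * clicks I a i - clicks I a i *
    sInf {t | 0 ≤ t ∧ clicks I (x (Function.update b i t) S) i = clicks I a i}

/-- The bid enters only through the allocation, which has finitely many values; boundedness and
measurability of the utility follow. -/
theorem gspUtility_update (x : AllocationRule N J) (i : N) (vi y : ℝ) :
    gspUtility I x i vi (Function.update b i y) S =
      allocUtility I x b S i vi (x (Function.update b i y) S) := by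
  simp only [gspUtility, gspPayment, gspCpc, allocUtility, Function.update_idem]

theorem exists_gspUtility_bound (x : AllocationRule N J) (i : N) (vi : ℝ) :
    ∃ C, ∀ y, |gspUtility I x i vi (Function.update b i y) S| ≤ C := by
  obtain ⟨C, hC⟩ := (Set.finite_range fun a => |allocUtility I x b S i vi a|).bddAbove
  exact ⟨C, fun y => hC ⟨x (Function.update b i y) S, by rw [gspUtility_update]⟩⟩

theorem integrable_mixUtility (μ : Measure ℝ) [IsFiniteMeasure μ] (i : N) (vi : ℝ) :
    Integrable (fun y => mixUtility I T i vi (Function.update b i y) S) μ := by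
  unfold mixUtility
  obtain ⟨C₁, h₁⟩ := exists_gspUtility_bound (I := I) (b := b) (S := S) (bpbRule I T) i vi
  obtain ⟨C₂, h₂⟩ := exists_gspUtility_bound (I := I) (b := b) (S := S) (maxRule I T) i vi
  refine ((Integrable.of_bound ?_ C₁ (ae_of_all _ h₁)).const_mul _).add
    ((Integrable.of_bound ?_ C₂ (ae_of_all _ h₂)).const_mul _)
  · simp only [gspUtility_update]
    exact (measurable_comp_bpbRule i (allocUtility I (bpbRule I T) b S i vi)).aestronglyMeasurable
  · simp only [gspUtility_update]
    exact (measurable_comp_maxRule i (allocUtility I (maxRule I T) b S i vi)).aestronglyMeasurable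

/-! ### The deviation law -/

theorem one_sub_inv_exp_pos : 0 < 1 - 1 / Real.exp 1 := by
  have h : 1 < Real.exp 1 := by simp
  have := (div_lt_one (Real.exp_pos 1)).2 h
  linarith

theorem one_sub_inv_exp_lt_one : 1 - 1 / Real.exp 1 < 1 := by
  have := one_div_pos.2 (Real.exp_pos 1)
  linarith

theorem deviationLaw_of_pos {x : ℝ} (hx : 0 < x) : deviationLaw x =
    (volume.restrict (Set.Icc 0 (x * (1 - 1 / Real.exp 1)))).withDensity
      (fun y => ENNReal.ofReal (1 / (x - y))) := if_pos hx

theorem deviationLaw_zero : deviationLaw 0 = Measure.dirac 0 := if_neg (lt_irrefl 0)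

theorem mul_one_sub_inv_exp_lt {x : ℝ} (hx : 0 < x) : x * (1 - 1 / Real.exp 1) < x :=
  mul_lt_of_lt_one_right hx one_sub_inv_exp_lt_one

/-- At the right endpoint `x - y` equals `x / e`, so `-log (x - y)` grows by exactly 1. -/
theorem integral_one_div_sub {x : ℝ} (hx : 0 < x) :
    ∫ y in (0)..(x * (1 - 1 / Real.exp 1)), 1 / (x - y) = 1 := by
  have hlt := mul_one_sub_inv_exp_lt hx
  have h0 : 0 ≤ x * (1 - 1 / Real.exp 1) := (mul_pos hx one_sub_inv_exp_pos).le
  have hpos : ∀ y ∈ Set.uIcc 0 (x * (1 - 1 / Real.exp 1)), x - y ≠ 0 := by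
    intro y hy
    rw [Set.uIcc_of_le h0] at hy
    linarith [hy.2]
  have hd : ∀ y ∈ Set.uIcc 0 (x * (1 - 1 / Real.exp 1)),
      HasDerivAt (fun y => -Real.log (x - y)) (1 / (x - y)) y := by
    intro y hy
    have : HasDerivAt (fun y => -Real.log (x - y)) (-(-1 / (x - y))) y :=
      (((hasDerivAt_id y).const_sub x).log (hpos y hy)).neg
    rwa [neg_div, neg_neg] at this
  rw [intervalIntegral.integral_eq_sub_of_hasDerivAt hd]
  · have e : x - x * (1 - 1 / Real.exp 1) = x / Real.exp 1 := by ring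
    rw [e, Real.log_div hx.ne' (Real.exp_pos 1).ne', Real.log_exp, sub_zero]
    ring
  · refine ContinuousOn.intervalIntegrable ?_
    exact ContinuousOn.div continuousOn_const (by fun_prop) hpos

theorem integrableOn_one_div_sub {x : ℝ} (hx : 0 < x) :
    IntegrableOn (fun y => 1 / (x - y)) (Set.Icc 0 (x * (1 - 1 / Real.exp 1))) := by
  have hlt := mul_one_sub_inv_exp_lt hx
  refine ContinuousOn.integrableOn_Icc (ContinuousOn.div continuousOn_const (by fun_prop) ?_)
  intro y hy
  linarith [hy.2]

theorem isProbabilityMeasure_deviationLaw {x : ℝ} (hx : 0 ≤ x) :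
    IsProbabilityMeasure (deviationLaw x) := by
  rcases hx.eq_or_lt with rfl | hx
  · rw [deviationLaw_zero]; infer_instance
  have hlt := mul_one_sub_inv_exp_lt hx
  have h0 : 0 ≤ x * (1 - 1 / Real.exp 1) := (mul_pos hx one_sub_inv_exp_pos).le
  refine ⟨?_⟩
  rw [deviationLaw_of_pos hx, withDensity_apply _ MeasurableSet.univ, Measure.restrict_univ,
    ← ofReal_integral_eq_lintegral_ofReal (integrableOn_one_div_sub hx), integral_Icc_eq_integral_Ioc,
    ← intervalIntegral.integral_of_le h0, integral_one_div_sub hx, ENNReal.ofReal_one]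
  filter_upwards [ae_restrict_mem measurableSet_Icc] with y hy
  have : 0 < x - y := by linarith [hy.2]
  positivity

theorem deviationLaw_ae_nonneg (x : ℝ) : ∀ᵐ y ∂(deviationLaw x), 0 ≤ y := by
  by_cases hx : 0 < x
  · rw [deviationLaw_of_pos hx]
    refine (withDensity_absolutelyContinuous _ _).ae_le ?_
    filter_upwards [ae_restrict_mem measurableSet_Icc] with y hy using hy.1
  · rw [deviationLaw, if_neg hx, ae_dirac_iff measurableSet_Ici]

/-- If all bids above `t` give the deviating advertiser at least `a` clicks at a price of at most
the bid, then the expected utility of the deviation is at least `a * (x * (1 - 1 / e) - t)`. -/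
theorem le_integral_deviationLaw {x a t : ℝ} {U : ℝ → ℝ} (hx : 0 ≤ x) (ht : 0 ≤ t) (ha : 0 ≤ a)
    (hU : Integrable U (deviationLaw x)) (h0 : ∀ y, 0 ≤ y → y ≤ x → 0 ≤ U y)
    (h1 : ∀ y, y ≤ x → t < y → (x - y) * a ≤ U y) :
    a * (x * (1 - 1 / Real.exp 1) - t) ≤ ∫ y, U y ∂(deviationLaw x) := by
  rcases hx.eq_or_lt with rfl | hx
  · rw [deviationLaw_zero, integral_dirac]
    have := h0 0 le_rfl le_rfl
    have := mul_nonneg ha ht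
    linarith
  have hlt := mul_one_sub_inv_exp_lt hx
  set c := x * (1 - 1 / Real.exp 1) with hc
  have hm : Measurable fun y => ENNReal.ofReal (1 / (x - y)) := by fun_prop
  have hpos : ∀ y ∈ Set.Icc 0 c, 0 < x - y := fun y hy => by linarith [hy.2]
  have hsm : ∀ y ∈ Set.Icc 0 c, (ENNReal.ofReal (1 / (x - y))).toReal • U y = U y / (x - y) := by
    intro y hy
    have := hpos y hy
    rw [ENNReal.toReal_ofReal (by positivity), smul_eq_mul]
    ring
  rw [deviationLaw_of_pos hx] at hU ⊢
  rw [integrable_withDensity_iff_integrable_smul' hm (ae_of_all _ fun _ => ENNReal.ofReal_lt_top)]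
    at hU
  rw [integral_withDensity_eq_integral_toReal_smul hm
    (ae_of_all _ fun _ => ENNReal.ofReal_lt_top), setIntegral_congr_fun measurableSet_Icc hsm]
  have hU' : IntegrableOn (fun y => U y / (x - y)) (Set.Icc 0 c) :=
    (integrableOn_congr_fun hsm measurableSet_Icc).1 hU
  have hsub : Set.Ioc t c ⊆ Set.Icc 0 c := fun y hy => ⟨ht.trans hy.1.le, hy.2⟩
  calc a * (c - t) ≤ ∫ _ in Set.Ioc t c, a := by
        rw [setIntegral_const, smul_eq_mul, Real.volume_real_Ioc, mul_comm]
        -- If `t > c`, the interval is empty and the left side is nonpositive.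
        exact mul_le_mul_of_nonneg_right (le_max_left _ _) ha
    _ ≤ ∫ y in Set.Ioc t c, U y / (x - y) := by
        refine setIntegral_mono_on (by simp) (hU'.mono_set hsub) measurableSet_Ioc fun y hy => ?_
        rw [le_div_iff₀ (hpos y (hsub hy)), mul_comm]
        exact h1 y (hy.2.trans hlt.le) hy.1
    _ ≤ ∫ y in Set.Icc 0 c, U y / (x - y) := by
        refine setIntegral_mono_set hU' ?_ hsub.eventuallyLE
        filter_upwards [ae_restrict_mem measurableSet_Icc] with y hy
        exact div_nonneg (h0 y hy.1 (hy.2.trans hlt.le)) (hpos y hy).le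

/-! ### Semi-smoothness -/

/-- The expected utility of `i` after a random deviation. -/
def devUtility (I : Instance N J) (T : TieBreaking N J) (v : N → ℝ) (A : N → Finset J)
    (b : N → ℝ) (S : N → Finset J) (i : N) : ℝ :=
  ∫ y, mixUtility I T i (v i) (Function.update b i y) (Function.update S i (A i))
    ∂(deviationLaw (v i))

theorem gspUtility_nonneg (x : AllocationRule N J) (i : N) {vi y : ℝ} (hy : 0 ≤ y) (hv : y ≤ vi) :
    0 ≤ gspUtility I x i vi (Function.update b i y) S :=
  (mul_nonneg (sub_nonneg.2 hv) (clicks_nonneg _ _)).trans (le_gspUtility x i vi y hy)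

/-- One rule supplies the clicks, with probability 1/2; the other contributes nonnegative utility,
as bids in the support stay below the value. -/
theorem le_devUtility (h : NoOverbidding v A b S) {i : N} {a t : ℝ} (ht : 0 ≤ t) (ha : 0 ≤ a)
    (hc : ∀ y, t < y → a ≤ clicks I (bpbRule I T (devBid b i y) (devSet S A i)) i ∨
      a ≤ clicks I (maxRule I T (devBid b i y) (devSet S A i)) i) :
    1 / 2 * (a * (v i * (1 - 1 / Real.exp 1) - t)) ≤ devUtility I T v A b S i := by
  have := isProbabilityMeasure_deviationLaw (h.value_nonneg i)
  rw [← mul_assoc]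
  refine le_integral_deviationLaw (h.value_nonneg i) ht (by positivity)
    (integrable_mixUtility _ i (v i)) (fun y hy hyv => ?_) fun y hyv hty => ?_
  · have h1 := gspUtility_nonneg (I := I) (b := b) (S := devSet S A i) (bpbRule I T) i hy hyv
    have h2 := gspUtility_nonneg (I := I) (b := b) (S := devSet S A i) (maxRule I T) i hy hyv
    unfold mixUtility
    linarith
  · have hy : 0 ≤ y := ht.trans hty.le
    have h1 := gspUtility_nonneg (I := I) (b := b) (S := devSet S A i) (bpbRule I T) i hy hyv
    have h2 := gspUtility_nonneg (I := I) (b := b) (S := devSet S A i) (maxRule I T) i hy hyv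
    have h3 := le_gspUtility (I := I) (b := b) (S := devSet S A i) (bpbRule I T) i (v i) y hy
    have h4 := le_gspUtility (I := I) (b := b) (S := devSet S A i) (maxRule I T) i (v i) y hy
    unfold mixUtility
    rcases hc y hty with h5 | h5 <;>
    · have := mul_le_mul_of_nonneg_left h5 (sub_nonneg.2 hyv)
      linarith

theorem devUtility_nonneg (h : NoOverbidding v A b S) (i : N) :
    0 ≤ devUtility I T v A b S i := by
  simpa using le_devUtility (I := I) (T := T) h (i := i) le_rfl le_rfl
    (fun y _ => Or.inl (clicks_nonneg _ _))

/-- Deviating recovers, up to the share of the space, the value of any ad. -/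
theorem val_sub_le_devUtility (h : NoOverbidding v A b S) (i : N) (j : J) :
    1 / 2 * (1 - 1 / Real.exp 1) * val I v A i j -
      (welfare I v A (bpbRule I T b S) + welfare I v A (maxRule I T b S)) * (I.w i j / I.W) ≤
    devUtility I T v A b S i := by
  have hB := welfare_nonneg (I := I) (A := A) h.value_nonneg (bpbRule I T b S)
  have hM := welfare_nonneg (I := I) (A := A) h.value_nonneg (maxRule I T b S)
  have hw := I.w_pos i j
  have hW := I.W_pos
  set B := welfare I v A (bpbRule I T b S) with hBdef
  set M := welfare I v A (maxRule I T b S) with hMdef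
  have hr : 0 ≤ I.w i j / I.W := by positivity
  have hloss : 0 ≤ (B + M) * (I.w i j / I.W) := by positivity
  by_cases hv0 : val I v A i j = 0
  · have := devUtility_nonneg (I := I) (T := T) h i
    rw [hv0]
    linarith
  have hj : j ∈ A i := by
    by_contra hj; exact hv0 (if_neg hj)
  rw [val_of_mem hj] at hv0 ⊢
  have hα : 0 < I.α i j := lt_of_le_of_ne (I.α_nonneg i j) fun e => hv0 (by rw [← e, zero_mul])
  -- At most half the space: `W - w ≥ W/2` bounds the critical value by `2 F w / W`. More than half:
  -- the loss `M / 2` is at most `F * w / W`.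
  rcases le_or_gt (I.w i j) (I.W / 2) with hs | hs
  · have hd : 0 < I.W - I.w i j := by linarith
    have h1 := le_devUtility (T := T) h (i := i)
      (t := I.w i j * (B + M) / (I.W - I.w i j) / I.α i j) (by positivity) hα.le
      (fun y hy => Or.inl (le_clicks_bpbRule h hj hα (by linarith) hy))
    have h2 : I.α i j * (I.w i j * (B + M) / (I.W - I.w i j) / I.α i j) =
        I.w i j * (B + M) / (I.W - I.w i j) := by field_simp
    have h3 : I.w i j * (B + M) / (I.W - I.w i j) ≤ I.w i j * (B + M) / (I.W / 2) :=
      div_le_div_of_nonneg_left (by positivity) (by positivity) (by linarith)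
    have h4 : I.w i j * (B + M) / (I.W / 2) = 2 * ((B + M) * (I.w i j / I.W)) := by
      field_simp
    rw [mul_sub, h2] at h1
    linarith
  · have h1 := le_devUtility (T := T) h (i := i) (t := M / I.α i j) (by positivity) hα.le
      (fun y hy => Or.inr (le_clicks_maxRule h hj hα hy))
    have h2 : I.α i j * (M / I.α i j) = M := by field_simp
    have h3 : 1 / 2 ≤ I.w i j / I.W := by
      rw [le_div_iff₀ hW]; linarith
    have h4 := mul_le_mul_of_nonneg_left h3 (add_nonneg hB hM)
    rw [mul_sub, h2] at h1
    linarith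

theorem welfare_sub_le_sum_devUtility (h : NoOverbidding v A b S) (x : Allocation N J)
    (hx : ∑ i, usedSpace I x i ≤ I.W) :
    1 / 2 * (1 - 1 / Real.exp 1) * welfare I v A x - 2 * mixWelfare I T v A b S ≤
      ∑ i, devUtility I T v A b S i := by
  have hB := welfare_nonneg (I := I) (A := A) h.value_nonneg (bpbRule I T b S)
  have hM := welfare_nonneg (I := I) (A := A) h.value_nonneg (maxRule I T b S)
  have key : ∀ i, 1 / 2 * (1 - 1 / Real.exp 1) * (x i).elim 0 (val I v A i) -
      (welfare I v A (bpbRule I T b S) + welfare I v A (maxRule I T b S)) *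
        (usedSpace I x i / I.W) ≤ devUtility I T v A b S i := by
    intro i
    unfold usedSpace
    cases x i with
    | none =>
      simpa using devUtility_nonneg h i
    | some j => exact val_sub_le_devUtility h i j
  have hsum := Finset.sum_le_sum fun i (_ : i ∈ Finset.univ) => key i
  rw [Finset.sum_sub_distrib, ← Finset.mul_sum, ← Finset.mul_sum, ← Finset.sum_div] at hsum
  have h1 := mul_le_mul_of_nonneg_left ((div_le_one I.W_pos).2 hx) (add_nonneg hB hM)
  unfold mixWelfare
  have e : welfare I v A x = ∑ i, (x i).elim 0 (val I v A i) := rfl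
  rw [e]
  linarith

theorem semiSmoothVia_deviationLaw (I : Instance N J) (T : TieBreaking N J) :
    SemiSmoothVia I T ((1 / 2) * (1 - 1 / Real.exp 1)) 2 (fun _ x => deviationLaw x) := by
  refine ⟨fun _ x hx => ⟨isProbabilityMeasure_deviationLaw hx, deviationLaw_ae_nonneg x⟩,
    fun v A b S h => ⟨fun i => ?_, ?_⟩⟩
  · have := isProbabilityMeasure_deviationLaw (h.value_nonneg i)
    exact integrable_mixUtility _ i (v i)
  · have hlam : 0 < 1 / 2 * (1 - 1 / Real.exp 1) := mul_pos one_half_pos one_sub_inv_exp_pos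
    have hopt : optWelfare I v A ≤ (∑ i, devUtility I T v A b S i +
        2 * mixWelfare I T v A b S) / (1 / 2 * (1 - 1 / Real.exp 1)) := by
      -- The empty allocation shows that the set of feasible welfares is nonempty.
      refine csSup_le ⟨_, fun _ => none, by simp [usedSpace, I.W_pos.le], rfl⟩ ?_
      rintro _ ⟨x, hx, rfl⟩
      rw [le_div_iff₀ hlam]
      have := welfare_sub_le_sum_devUtility (T := T) h x hx
      linarith
    rw [le_div_iff₀ hlam] at hopt
    change _ ≤ ∑ i, devUtility I T v A b S i
    linarith

end RichAds

end

theorem mainTheorem7 {N J : Type*} [Fintype N] [DecidableEq N] [Fintype J] [DecidableEq J]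
    (I : RichAds.Instance N J) (T : RichAds.TieBreaking N J) :
    RichAds.SemiSmooth I T ((1 / 2) * (1 - 1 / Real.exp 1)) 2 ∧
    RichAds.SemiSmoothVia I T ((1 / 2) * (1 - 1 / Real.exp 1)) 2
      (fun _ x => RichAds.deviationLaw x) :=
  ⟨⟨_, RichAds.semiSmoothVia_deviationLaw I T⟩, RichAds.semiSmoothVia_deviationLaw I T⟩
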